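/- Let $S$ be a closed connected surface with a complex structure $X_0$, and let $q_0$ be a nonzero holomorphic quadratic differential on $(S,X_0)$, so that $(S,X_0,q_0)$ is a flat surface whose cone points are the zeros of $q_0$. Let $D$ be its Teichmüller disk: its points are the complex structures $X=A\cdot X_0$, $A\in \mathrm{SL}_2(\mathbb R)$, each with the quadratic differential $q=A\cdot q_0$, where $A\cdot(X_0,q_0)$ has the same cone points as $(X_0,q_0)$ and its natural coordinates are $A\circ\zeta$, for $\zeta$ a natural coordinate of $q_0$ (a local holomorphic coordinate away from the cone points with $d\zeta^2=q_0$). A saddle connection of $(S,X,q)$ is a straight segment for the flat metric $|q|$ whose endpoints are cone points and whose interior contains no cone point. A Euclidean triangle in $(S,X,q)$ is a nondegenerate closed triangle $T\subset\mathbb C$ together with a continuous map $\varphi:T\to S$ such that $\varphi^*q=dz^2$ in the interior of $T$ (that is, $\varphi$ is locally isometric there) and such that each of the three sides of $T$ is mapped to a single saddle connection; $\varphi$ is not assumed to be injective. Its area is the area of $T$ in the plane. Then there is an $A>0$ such that for every $X\in D$, every Euclidean triangle in $(S,X,q)$ has area at most $A$. Moreover $A$ can be taken to be the area $\int_S|q_0|$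 of the flat surface, which is positive and finite. -/

import Mathlib

open Set MeasureTheory
open scoped Manifold ContDiff ENNReal

noncomputable section

/-- A complex structure on the topological space `S`: an atlas of charts to `ℂ` with
biholomorphic transition functions (over `ℂ`, analytic is the same as holomorphic). -/
structure ComplexStructure (S : Type*) [TopologicalSpace S] extends ChartedSpace ℂ S where
  isManifold : IsManifold 𝓘(ℂ, ℂ) ω S

/-- A flat structure `(X, q)` on `S`: a complex structure `X` together with a nonzero holomorphic
quadratic differential `q`, i.e. a holomorphic section of the square of the canonical bundle.
It is written in the charts `e` of `X` as `q e w dw²`; only the values of `q e` on the range of `e`,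
for charts `e` in the atlas, are meaningful. -/
structure FlatStructure (S : Type*) [TopologicalSpace S] extends ComplexStructure S where
  q : OpenPartialHomeomorph S ℂ → ℂ → ℂ
  holomorphic : ∀ e ∈ atlas, DifferentiableOn ℂ (q e) e.target
  transform : ∀ e ∈ atlas, ∀ e' ∈ atlas, ∀ p ∈ e.source ∩ e'.source,
    q e (e p) = q e' (e' p) * (deriv (e' ∘ e.symm) (e p)) ^ 2
  nonzero : ∃ e ∈ atlas, ∃ w ∈ e.target, q e w ≠ 0

/-- The real linear action of `SL(2,ℝ)` on `ℂ = ℝ²`. -/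
def slAct (A : Matrix.SpecialLinearGroup (Fin 2) ℝ) (z : ℂ) : ℂ :=
  ⟨A.1 0 0 * z.re + A.1 0 1 * z.im, A.1 1 0 * z.re + A.1 1 1 * z.im⟩

namespace FlatStructure

variable {S : Type*} [TopologicalSpace S]

/-- The cone points of the flat structure: the zeros of `q`. -/
def conePoints (F : FlatStructure S) : Set S :=
  {p | ∃ e ∈ F.atlas, p ∈ e.source ∧ F.q e (e p) = 0}

/-- `ζ` is a natural coordinate on the open set `U`, which contains no cone point: `ζ` is
injective on `U` and holomorphic there with `dζ² = q`. -/
def IsNaturalCoordinate (F : FlatStructure S) (U : Set S) (ζ : S → ℂ) : Prop :=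
  IsOpen U ∧ Disjoint U F.conePoints ∧ InjOn ζ U ∧
    ∀ p ∈ U, ∀ e ∈ F.atlas, p ∈ e.source →
      ∃ d : ℂ, HasDerivAt (ζ ∘ e.symm) d (e p) ∧ d ^ 2 = F.q e (e p)

/-- `F' = A · F`: the two structures live on the same surface `S` and have the same cone points,
and the natural coordinates `ζ` of `F` give the natural coordinates `A ∘ ζ` of `F'`. -/
def IsDeformation (A : Matrix.SpecialLinearGroup (Fin 2) ℝ) (F F' : FlatStructure S) : Prop :=
  F'.conePoints = F.conePoints ∧
    ∀ (U : Set S) (ζ : S → ℂ), F.IsNaturalCoordinate U ζ → F'.IsNaturalCoordinate U (slAct A ∘ ζ)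

/-- The Teichmüller disk of `F`, each of its points being represented by the flat structures
`(X, q_X)` in the `SL(2,ℝ)`-orbit of `F`. -/
def teichmullerDisk (F : FlatStructure S) : Set (FlatStructure S) :=
  {F' | ∃ A : Matrix.SpecialLinearGroup (Fin 2) ℝ, IsDeformation A F F'}

/-- The area `∫_S |q|` of the flat surface: the supremum, over all finite families of pairwise
disjoint measurable pieces of `S`, each lying in the domain of a chart, of the total area of the
pieces, where the area element in a chart `e` is `|q e w| dx dy`. -/
def area (F : FlatStructure S) : ℝ≥0∞ :=
  ⨆ (n : ℕ) (e : Fin n → OpenPartialHomeomorph S ℂ) (E : Fin n → Set S)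
    (_ : ∀ i, e i ∈ F.atlas ∧ E i ⊆ (e i).source ∧ MeasurableSet (e i '' E i))
    (_ : Pairwise fun i j => Disjoint (E i) (E j)),
    ∑ i, ∫⁻ w in e i '' E i, ‖F.q (e i) w‖ₑ

/-- A saddle connection, parametrized by `[0,1]` with constant speed: its endpoints are cone
points, its interior contains none, and it is a straight segment in the natural coordinates,
i.e. the value of `q` on its velocity vector is a nonzero constant `v²` (so that it develops to a
segment with direction `±v` and length `|v|`). -/
def IsSaddleConnection (F : FlatStructure S) (γ : ℝ → S) : Prop :=
  ContinuousOn γ (Icc 0 1) ∧ γ 0 ∈ F.conePoints ∧ γ 1 ∈ F.conePoints ∧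
    ∃ v : ℂ, v ≠ 0 ∧ ∀ t ∈ Ioo (0 : ℝ) 1, γ t ∉ F.conePoints ∧
      ∀ e ∈ F.atlas, γ t ∈ e.source →
        ∃ d : ℂ, HasDerivAt (e ∘ γ) d t ∧ F.q e (e (γ t)) * d ^ 2 = v ^ 2

/-- A Euclidean triangle in the flat surface: a nondegenerate triangle in the plane `ℂ`, mapped to
`S` continuously, so that the map is locally isometric in the interior (a local inverse of
natural coordinates: `q` pulls back to `dz²`) and each of the three sides is mapped to a single
saddle connection. The map is not required to be injective. -/
structure EuclideanTriangle (F : FlatStructure S) where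
  vertex : Fin 3 → ℂ
  nondegenerate : AffineIndependent ℝ vertex
  toFun : ℂ → S
  continuousOn : ContinuousOn toFun (convexHull ℝ (range vertex))
  isometric : ∀ z ∈ interior (convexHull ℝ (range vertex)), ∀ e ∈ F.atlas, toFun z ∈ e.source →
    ∃ d : ℂ, HasDerivAt (e ∘ toFun) d z ∧ F.q e (e (toFun z)) * d ^ 2 = 1
  sides : ∀ i j, i ≠ j →
    F.IsSaddleConnection fun t : ℝ => toFun (AffineMap.lineMap (vertex i) (vertex j) t)

/-- The area of a Euclidean triangle (counted with multiplicity in `S`). -/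
def EuclideanTriangle.area {F : FlatStructure S} (T : F.EuclideanTriangle) : ℝ :=
  volume.real (convexHull ℝ (range T.vertex))

end FlatStructure

end

/-!
Let `φ` map a Euclidean triangle `T` to a deformation `F` of `F₀`. The bound holds because `φ` is
injective in the interior of `T` (`EuclideanTriangle.injOn_interior`), so that the area of `T` is
that of a subset of the surface.

Suppose that `φ a = φ b` for distinct interior points. In natural coordinates `φ` has derivative
`±1`, so the germs of `φ` at `a` and `b` differ by a translation or by a half-turn, and by
continuation along the convex overlap `φ` is invariant under this plane isometry `ψ`
(`IsLocalIsometryOn.eq_of_eventually_eq`). A half-turn would fix the midpoint of `a` and `b`, where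
`φ` is locally injective (`IsLocalIsometryOn.exists_translation`). For a translation, two of the
three barycentric coordinates vary in the same direction from `a` to `b`; hence `ψ` or its inverse
moves the third vertex to a point of `T` that is not a vertex. But vertices are mapped to cone
points, while no interior point and no interior point of a side is
(`EuclideanTriangle.false_of_forall_coord_le`).

To compare areas, the interior of `T` is cut into countably many pieces `P`, each mapped into the
domain of a natural coordinate `ζ` of `F₀`. If `F = A · F₀`, then `A ∘ ζ ∘ φ` has derivative `±1` on
`P`, and `A` preserves the area, so `P` has the area of `ζ (φ P)`, which is the integral of `|q₀|`
over `φ P` (`IsLocalIsometryOn.volume_eq_lintegral`, `IsLocalIsometryOn.volume_le_area`). Natural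
coordinates exist away from the cone points because `q₀` has a holomorphic square root there, with
a locally injective primitive (`exists_isNaturalCoordinate`).

The area of `F₀` is positive because `q₀` is nonzero on an open set (`area_pos`), and finite because
the surface is covered by finitely many open sets of finite area (`area_lt_top`).
-/

noncomputable section

/-! ### Change of variables for holomorphic and special linear maps -/

/-- The real Jacobian of a holomorphic map `f` is `|f'|²`. -/
theorem lintegral_image_eq_lintegral_enorm_deriv_sq_mul {s : Set ℂ} (hs : MeasurableSet s)
    {f f' : ℂ → ℂ} (hf' : ∀ z ∈ s, HasDerivAt f (f' z) z) (hf : InjOn f s) (g : ℂ → ℝ≥0∞) :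
    ∫⁻ w in f '' s, g w = ∫⁻ z in s, ‖f' z‖ₑ ^ 2 * g (f z) := by
  rw [lintegral_image_eq_lintegral_abs_det_fderiv_mul volume hs
    (fun z hz => ((hf' z hz).hasFDerivAt.restrictScalars ℝ).hasFDerivWithinAt) hf]
  refine setLIntegral_congr_fun hs fun z _ => ?_
  have hdet : (((ContinuousLinearMap.toSpanSingleton ℂ (f' z)).restrictScalars ℝ).det : ℝ) =
      ‖f' z‖ ^ 2 := by
    have h : (((ContinuousLinearMap.toSpanSingleton ℂ (f' z)).restrictScalars ℝ : ℂ →L[ℝ] ℂ) :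
        ℂ →ₗ[ℝ] ℂ) = Algebra.lmul ℝ ℂ (f' z) := by
      ext; simp [mul_comm]
    rw [ContinuousLinearMap.det, h, ← Algebra.norm_apply, Algebra.norm_complex_apply,
      Complex.normSq_eq_norm_sq]
  rw [hdet, abs_of_nonneg (by positivity), ENNReal.ofReal_pow (norm_nonneg _), ofReal_norm]

theorem volume_image_slAct (A : Matrix.SpecialLinearGroup (Fin 2) ℝ) (s : Set ℂ) :
    volume (slAct A '' s) = volume s := by
  let L : ℂ →ₗ[ℝ] ℂ := Matrix.toLin Complex.basisOneI Complex.basisOneI A.1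
  have hL : slAct A = L := by
    funext z
    have : L z = ∑ j, ((A.1.mulVec (Complex.basisOneI.repr z)) j) • Complex.basisOneI j :=
      Matrix.toLin_apply _ _ _ _
    rw [this]
    apply Complex.ext <;> simp [slAct, Matrix.mulVec, dotProduct, Fin.sum_univ_two]
  rw [hL, Measure.addHaar_image_linearMap, LinearMap.det_toLin, A.2]
  simp

/-! ### Area in charts -/

namespace FlatStructure

variable {S : Type*} [TopologicalSpace S] {F F₀ : FlatStructure S}

theorem hasDerivAt_transition (F : FlatStructure S) {e e' : OpenPartialHomeomorph S ℂ}
    (he : e ∈ F.atlas) (he' : e' ∈ F.atlas) {p : S} (hp : p ∈ e.source) (hp' : p ∈ e'.source) :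
    HasDerivAt (e' ∘ e.symm) (deriv (e' ∘ e.symm) (e p)) (e p) := by
  let := F.toChartedSpace
  have := F.isManifold
  have h := (contDiffGroupoid ω 𝓘(ℂ, ℂ)).compatible he he'
  rw [contDiffGroupoid, mem_groupoid_of_pregroupoid] at h
  have h3 : ContDiffOn ℂ ω (e' ∘ e.symm) (e.symm.trans e').source := by
    simpa [contDiffPregroupoid] using h.1
  have hmem : e p ∈ (e.symm.trans e').source := by
    simp [hp, hp']
  exact ((h3.differentiableOn (by simp)).differentiableAt
    ((e.symm.trans e').open_source.mem_nhds hmem)).hasDerivAt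

/-- The image of `E` in the chart `e'` is the image of its image in `e` under the transition. -/
theorem image_transition_image {e e' : OpenPartialHomeomorph S ℂ} {E : Set S}
    (hE : E ⊆ e.source) : (e' ∘ e.symm) '' (e '' E) = e' '' E := by
  rw [image_image]
  exact image_congr fun p hp => by simp [e.left_inv (hE hp)]

/-- Measurability of a piece of the surface does not depend on the chart in which it is read. -/
theorem measurableSet_image_chart {e e' : OpenPartialHomeomorph S ℂ} {E : Set S}
    (hE : E ⊆ e.source) (hE' : E ⊆ e'.source) (hm : MeasurableSet (e '' E)) :
    MeasurableSet (e' '' E) := by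
  rw [← image_transition_image hE]
  refine hm.image_of_continuousOn_injOn ?_ ?_
  · refine e'.continuousOn.comp (e.symm.continuousOn.mono ?_) ?_
    · rintro _ ⟨p, hp, rfl⟩
      exact e.map_source (hE hp)
    · rintro _ ⟨p, hp, rfl⟩
      simpa [e.left_inv (hE hp)] using hE' hp
  · rintro _ ⟨p, hp, rfl⟩ _ ⟨p', hp', rfl⟩ h
    simp only [Function.comp_apply, e.left_inv (hE hp), e.left_inv (hE hp')] at h
    rw [e'.injOn (hE' hp) (hE' hp') h]

/-- The area form `|q| dx dy` does not depend on the chart. -/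
theorem lintegral_enorm_q_eq (F : FlatStructure S) {e e' : OpenPartialHomeomorph S ℂ}
    (he : e ∈ F.atlas) (he' : e' ∈ F.atlas) {E : Set S} (hE : E ⊆ e.source) (hE' : E ⊆ e'.source)
    (hm : MeasurableSet (e '' E)) :
    ∫⁻ w in e '' E, ‖F.q e w‖ₑ = ∫⁻ w in e' '' E, ‖F.q e' w‖ₑ := by
  rw [← image_transition_image (e' := e') hE,
    lintegral_image_eq_lintegral_enorm_deriv_sq_mul hm (f' := deriv (e' ∘ e.symm))]
  · refine setLIntegral_congr_fun hm ?_
    rintro _ ⟨p, hp, rfl⟩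
    dsimp only
    rw [F.transform e he e' he' p ⟨hE hp, hE' hp⟩, enorm_mul, enorm_pow, mul_comm,
      Function.comp_apply, e.left_inv (hE hp)]
  · rintro _ ⟨p, hp, rfl⟩
    exact F.hasDerivAt_transition he he' (hE hp) (hE' hp)
  · rintro _ ⟨p, hp, rfl⟩ _ ⟨p', hp', rfl⟩ h
    simp only [Function.comp_apply, e.left_inv (hE hp), e.left_inv (hE hp')] at h
    rw [e'.injOn (hE' hp) (hE' hp') h]

theorem sum_le_area (F : FlatStructure S) {n : ℕ} (e : Fin n → OpenPartialHomeomorph S ℂ)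
    (E : Fin n → Set S)
    (h : ∀ i, e i ∈ F.atlas ∧ E i ⊆ (e i).source ∧ MeasurableSet (e i '' E i))
    (hd : Pairwise fun i j => Disjoint (E i) (E j)) :
    ∑ i, ∫⁻ w in e i '' E i, ‖F.q (e i) w‖ₑ ≤ F.area :=
  le_iSup_of_le n <| le_iSup_of_le e <| le_iSup_of_le E <| le_iSup_of_le h <|
    le_iSup_of_le hd le_rfl

theorem area_pos (F : FlatStructure S) : 0 < F.area := by
  obtain ⟨e, he, w, hw, hq⟩ := F.nonzero
  have h1 := F.sum_le_area (n := 1) (fun _ => e) (fun _ => e.source)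
    (fun _ => ⟨he, subset_rfl, by
      rw [e.image_source_eq_target]; exact e.open_target.measurableSet⟩)
    (fun i j hij => (hij (Subsingleton.elim i j)).elim)
  simp only [Fin.sum_univ_one, e.image_source_eq_target] at h1
  refine lt_of_lt_of_le ?_ h1
  have hc : ContinuousOn (fun z => ‖F.q e z‖) e.target := (F.holomorphic e he).continuousOn.norm
  have hV : IsOpen (e.target ∩ (fun z => ‖F.q e z‖) ⁻¹' Ioi (‖F.q e w‖ / 2)) :=
    hc.isOpen_inter_preimage e.open_target isOpen_Ioi
  have hwq : 0 < ‖F.q e w‖ := norm_pos_iff.2 hq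
  set V := e.target ∩ (fun z => ‖F.q e z‖) ⁻¹' Ioi (‖F.q e w‖ / 2)
  have hwV : w ∈ V := ⟨hw, by simp only [mem_preimage, mem_Ioi]; linarith⟩
  calc 0 < ENNReal.ofReal (‖F.q e w‖ / 2) * volume V :=
        ENNReal.mul_pos (by simpa using hq) (hV.measure_pos volume ⟨w, hwV⟩).ne'
    _ = ∫⁻ _ in V, ENNReal.ofReal (‖F.q e w‖ / 2) := by simp
    _ ≤ ∫⁻ z in V, ‖F.q e z‖ₑ := by
        refine setLIntegral_mono' hV.measurableSet fun z hz => ?_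
        rw [← ofReal_norm]
        exact ENNReal.ofReal_le_ofReal (le_of_lt hz.2)
    _ ≤ _ := lintegral_mono_set inter_subset_left

theorem exists_isOpen_area_lt_top (F : FlatStructure S) (p : S) :
    ∃ e ∈ F.atlas, ∃ U : Set S, IsOpen U ∧ p ∈ U ∧ U ⊆ e.source ∧
      ∫⁻ w in e '' U, ‖F.q e w‖ₑ < ⊤ := by
  let := F.toChartedSpace
  set e := chartAt ℂ p
  have he : e ∈ F.atlas := chart_mem_atlas ℂ p
  have hp : p ∈ e.source := mem_chart_source ℂ p
  obtain ⟨r, hr, hB⟩ := Metric.nhds_basis_closedBall.mem_iff.1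
    (e.open_target.mem_nhds (e.map_source hp))
  refine ⟨e, he, e.source ∩ e ⁻¹' Metric.ball (e p) r,
    e.continuousOn.isOpen_inter_preimage e.open_source Metric.isOpen_ball,
    ⟨hp, Metric.mem_ball_self hr⟩, inter_subset_left, ?_⟩
  obtain ⟨C, hC⟩ := (isCompact_closedBall (e p) r).exists_bound_of_continuousOn
    ((F.holomorphic e he).continuousOn.mono hB)
  have hsub : e '' (e.source ∩ e ⁻¹' Metric.ball (e p) r) ⊆ Metric.closedBall (e p) r := by
    rintro _ ⟨x, hx, rfl⟩
    exact Metric.ball_subset_closedBall hx.2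
  calc _ ≤ ∫⁻ w in Metric.closedBall (e p) r, ‖F.q e w‖ₑ := lintegral_mono_set hsub
    _ ≤ ∫⁻ _ in Metric.closedBall (e p) r, ENNReal.ofReal C := by
        refine setLIntegral_mono' measurableSet_closedBall fun z hz => ?_
        rw [← ofReal_norm]
        exact ENNReal.ofReal_le_ofReal (hC z hz)
    _ < ⊤ := by
        simp only [lintegral_const, MeasurableSet.univ, Measure.restrict_apply, univ_inter]
        exact ENNReal.mul_lt_top ENNReal.ofReal_lt_top measure_closedBall_lt_top

/-- On a compact surface the area is finite: it is at most the sum of the areas of finitely many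
open sets of finite area that cover the surface. -/
theorem area_lt_top [CompactSpace S] (F : FlatStructure S) : F.area < ⊤ := by
  choose c hc U hU hpU hUc hfin using F.exists_isOpen_area_lt_top
  obtain ⟨t, ht⟩ := isCompact_univ.elim_finite_subcover U hU
    fun p _ => mem_iUnion.2 ⟨p, hpU p⟩
  suffices F.area ≤ ∑ p ∈ t, ∫⁻ w in c p '' U p, ‖F.q (c p) w‖ₑ from
    this.trans_lt (ENNReal.sum_lt_top.2 fun p _ => hfin p)
  refine iSup_le fun n => iSup_le fun e => iSup_le fun E => iSup_le fun h => iSup_le fun hd => ?_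
  have hm : ∀ i p, MeasurableSet (e i '' (E i ∩ U p)) := fun i p => by
    have : e i '' (E i ∩ U p) =
        e i '' E i ∩ ((e i).target ∩ (e i).symm ⁻¹' U p) := by
      ext w
      constructor
      · rintro ⟨x, hx, rfl⟩
        have hxs := (h i).2.1 hx.1
        exact ⟨⟨x, hx.1, rfl⟩, (e i).map_source hxs, by simpa [(e i).left_inv hxs] using hx.2⟩
      · rintro ⟨⟨x, hx, rfl⟩, -, hx2⟩
        have hxs := (h i).2.1 hx
        exact ⟨x, ⟨hx, by simpa [(e i).left_inv hxs] using hx2⟩, rfl⟩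
    rw [this]
    exact (h i).2.2.inter ((e i).isOpen_inter_preimage_symm (hU p)).measurableSet
  have hm' : ∀ i p, MeasurableSet (c p '' (E i ∩ U p)) := fun i p =>
    measurableSet_image_chart (inter_subset_left.trans (h i).2.1)
      (inter_subset_right.trans (hUc p)) (hm i p)
  calc ∑ i, ∫⁻ w in e i '' E i, ‖F.q (e i) w‖ₑ
      ≤ ∑ i, ∑ p ∈ t, ∫⁻ w in e i '' (E i ∩ U p), ‖F.q (e i) w‖ₑ := by
        refine Finset.sum_le_sum fun i _ => ?_
        rw [← Finset.sum_coe_sort t (fun p => ∫⁻ w in e i '' (E i ∩ U p), ‖F.q (e i) w‖ₑ),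
          ← tsum_fintype (L := .unconditional _)]
        refine le_trans (lintegral_mono_set ?_)
          (lintegral_iUnion_le (fun p : t => e i '' (E i ∩ U p)) _)
        rw [← image_iUnion, ← inter_iUnion]
        refine image_mono fun x hx => ⟨hx, ?_⟩
        simpa using ht (mem_univ x)
    _ = ∑ i, ∑ p ∈ t, ∫⁻ w in c p '' (E i ∩ U p), ‖F.q (c p) w‖ₑ :=
        Finset.sum_congr rfl fun i _ => Finset.sum_congr rfl fun p _ =>
          F.lintegral_enorm_q_eq (h i).1 (hc p) (inter_subset_left.trans (h i).2.1)
            (inter_subset_right.trans (hUc p)) (hm i p)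
    _ = ∑ p ∈ t, ∑ i, ∫⁻ w in c p '' (E i ∩ U p), ‖F.q (c p) w‖ₑ := Finset.sum_comm
    _ ≤ ∑ p ∈ t, ∫⁻ w in c p '' U p, ‖F.q (c p) w‖ₑ := by
        refine Finset.sum_le_sum fun p _ => ?_
        rw [← tsum_fintype (L := .unconditional _), ← lintegral_iUnion (fun i => hm' i p)]
        · exact lintegral_mono_set (iUnion_subset fun i => image_mono inter_subset_right)
        · intro i j hij
          refine disjoint_image_image fun x hx y hy hxy => ?_
          exact (hd hij).ne_of_mem hx.1 hy.1 ((c p).injOn (hUc p hx.2) (hUc p hy.2) hxy)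

end FlatStructure

/-! ### Natural coordinates -/

/-- A holomorphic function has, near a point where it does not vanish, the form `(G')²` with `G`
injective. -/
theorem exists_injOn_hasDerivAt_sq_eq {f : ℂ → ℂ} {V : Set ℂ} (hV : IsOpen V)
    (hf : DifferentiableOn ℂ f V) {a : ℂ} (ha : a ∈ V) (hfa : f a ≠ 0) :
    ∃ (G : ℂ → ℂ) (W : Set ℂ), IsOpen W ∧ a ∈ W ∧ W ⊆ V ∧ InjOn G W ∧
      ∀ z ∈ W, f z ≠ 0 ∧ ∃ d, HasDerivAt G d z ∧ d ^ 2 = f z := by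
  obtain ⟨s, hs⟩ := IsAlgClosed.exists_eq_mul_self (f a)
  have hcont : ContinuousOn (fun z => f z / f a) V := hf.continuousOn.div_const _
  have hO : IsOpen (V ∩ (fun z => f z / f a) ⁻¹' Complex.slitPlane) :=
    hcont.isOpen_inter_preimage hV Complex.isOpen_slitPlane
  obtain ⟨r, hr, hB⟩ := Metric.isOpen_iff.1 hO a ⟨ha, by simp [hfa]⟩
  -- The branch of `√f` near `a` that takes the value `s` at `a`.
  set g : ℂ → ℂ := fun z => s * Complex.exp (Complex.log (f z / f a) / 2) with hg
  have hgd : DifferentiableOn ℂ g (Metric.ball a r) := by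
    intro z hz
    have h1 : DifferentiableAt ℂ f z := hf.differentiableAt (hV.mem_nhds (hB hz).1)
    exact ((((h1.div_const _).clog (hB hz).2).div_const 2).cexp.const_mul s).differentiableWithinAt
  have hg2 : ∀ z ∈ Metric.ball a r, g z ^ 2 = f z := by
    intro z hz
    have hne : f z / f a ≠ 0 := Complex.slitPlane_ne_zero (hB hz).2
    rw [hg, mul_pow, ← Complex.exp_nat_mul]
    have : ((2 : ℕ) : ℂ) * (Complex.log (f z / f a) / 2) = Complex.log (f z / f a) := by
      push_cast; ring
    rw [this, Complex.exp_log hne, sq, ← hs]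
    field_simp
  obtain ⟨G, hG⟩ := hgd.isExactOn_ball
  have hGd : DifferentiableOn ℂ G (Metric.ball a r) :=
    fun z hz => (hG z hz).differentiableAt.differentiableWithinAt
  have haB : a ∈ Metric.ball a r := Metric.mem_ball_self hr
  have hstrict : HasStrictDerivAt G (g a) a := by
    have h1 : AnalyticAt ℂ G a := hGd.analyticAt (Metric.isOpen_ball.mem_nhds haB)
    simpa [(hG a haB).deriv] using h1.hasStrictDerivAt
  have hga : g a ≠ 0 := fun h => hfa (by rw [← hg2 a haB, h]; simp)
  set R := (hstrict.hasStrictFDerivAt_equiv hga).toOpenPartialHomeomorph G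
  refine ⟨G, Metric.ball a r ∩ R.source, Metric.isOpen_ball.inter R.open_source,
    ⟨haB, (hstrict.hasStrictFDerivAt_equiv hga).mem_toOpenPartialHomeomorph_source⟩,
    fun z hz => (hB hz.1).1, fun z hz w hw h => R.injOn hz.2 hw.2 h, fun z hz => ⟨?_, g z,
      hG z hz.1, hg2 z hz.1⟩⟩
  intro h0
  exact Complex.slitPlane_ne_zero (hB hz.1).2 (by simp [h0])

namespace FlatStructure

variable {S : Type*} [TopologicalSpace S] {F F₀ : FlatStructure S}

theorem exists_chart (F : FlatStructure S) (p : S) : ∃ e ∈ F.atlas, p ∈ e.source :=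
  let := F.toChartedSpace
  ⟨chartAt ℂ p, chart_mem_atlas ℂ p, mem_chart_source ℂ p⟩

theorem q_ne_zero (F : FlatStructure S) {e : OpenPartialHomeomorph S ℂ} (he : e ∈ F.atlas) {p : S}
    (hp : p ∈ e.source) (hpc : p ∉ F.conePoints) : F.q e (e p) ≠ 0 :=
  fun h => hpc ⟨e, he, hp, h⟩
/-- A point at which `q` does not vanish in one chart is not a cone point. -/
theorem notMem_conePoints (F : FlatStructure S) {e : OpenPartialHomeomorph S ℂ} (he : e ∈ F.atlas)
    {p : S} (hp : p ∈ e.source) (hq : F.q e (e p) ≠ 0) : p ∉ F.conePoints := by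
  rintro ⟨e', he', hp', h0⟩
  apply hq
  rw [F.transform e he e' he' p ⟨hp, hp'⟩, h0, zero_mul]

theorem exists_isNaturalCoordinate (F : FlatStructure S) {p : S} (hp : p ∉ F.conePoints) :
    ∃ e ∈ F.atlas, ∃ (U : Set S) (ζ : S → ℂ), p ∈ U ∧ U ⊆ e.source ∧
      F.IsNaturalCoordinate U ζ := by
  obtain ⟨e, he, hpe⟩ := F.exists_chart p
  obtain ⟨G, W, hW, hpW, hWt, hinj, hG⟩ := exists_injOn_hasDerivAt_sq_eq e.open_target
    (F.holomorphic e he) (e.map_source hpe) (F.q_ne_zero he hpe hp)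
  refine ⟨e, he, e.source ∩ e ⁻¹' W, G ∘ e, ⟨hpe, hpW⟩, inter_subset_left,
    e.isOpen_inter_preimage hW, ?_, ?_, ?_⟩
  · exact disjoint_left.2 fun x hx => F.notMem_conePoints he hx.1 (hG _ hx.2).1
  · exact fun x hx y hy h => e.injOn hx.1 hy.1 (hinj hx.2 hy.2 h)
  · intro x hx e' he' hxe'
    obtain ⟨-, d, hd, hd2⟩ := hG _ hx.2
    have ht := F.hasDerivAt_transition he' he hxe' hx.1
    refine ⟨d * deriv (e ∘ e'.symm) (e' x), ?_, ?_⟩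
    · have h1 : HasDerivAt G d ((e ∘ e'.symm) (e' x)) := by
        simpa [e'.left_inv hxe'] using hd
      exact h1.comp (e' x) ht
    · rw [mul_pow, hd2, F.transform e' he' e he x ⟨hxe', hx.1⟩]

/-! ### Local isometries from the plane -/

/-- `φ` is a local isometry from the open set `Ω` of the plane to the flat surface: it is
continuous and `q` pulls back to `dz²`. -/
structure IsLocalIsometryOn (F : FlatStructure S) (φ : ℂ → S) (Ω : Set ℂ) : Prop where
  isOpen : IsOpen Ω
  continuousOn : ContinuousOn φ Ω
  isometric : ∀ z ∈ Ω, ∀ e ∈ F.atlas, φ z ∈ e.source →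
    ∃ d : ℂ, HasDerivAt (e ∘ φ) d z ∧ F.q e (e (φ z)) * d ^ 2 = 1

namespace IsLocalIsometryOn

open scoped Topology
open Filter

variable {φ : ℂ → S} {Ω : Set ℂ}

theorem continuousAt (h : F.IsLocalIsometryOn φ Ω) {z : ℂ} (hz : z ∈ Ω) : ContinuousAt φ z :=
  h.continuousOn.continuousAt (h.isOpen.mem_nhds hz)

theorem notMem_conePoints (h : F.IsLocalIsometryOn φ Ω) {z : ℂ} (hz : z ∈ Ω) :
    φ z ∉ F.conePoints := by
  rintro ⟨e, he, hze, h0⟩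
  obtain ⟨d, -, hd⟩ := h.isometric z hz e he hze
  simp [h0] at hd

/-- Read in a natural coordinate, a local isometry has derivative `±1`. -/
theorem hasDerivAt_comp (h : F.IsLocalIsometryOn φ Ω) {U : Set S} {ζ : S → ℂ}
    (hζ : F.IsNaturalCoordinate U ζ) {z : ℂ} (hz : z ∈ Ω) (hzU : φ z ∈ U) :
    ∃ d : ℂ, HasDerivAt (ζ ∘ φ) d z ∧ d ^ 2 = 1 := by
  obtain ⟨e, he, hze⟩ := F.exists_chart (φ z)
  obtain ⟨d, hd, hd2⟩ := hζ.2.2.2 _ hzU e he hze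
  obtain ⟨d', hd', hd2'⟩ := h.isometric z hz e he hze
  refine ⟨d * d', ?_, by rw [mul_pow, hd2, hd2']⟩
  refine (HasDerivAt.comp z (h₂ := ζ ∘ e.symm) hd hd').congr_of_eventuallyEq ?_
  filter_upwards [(h.continuousAt hz).eventually_mem (e.open_source.mem_nhds hze)] with y hy
  simp [e.left_inv hy]

/-- Read in a natural coordinate, a local isometry is locally `u ↦ ±u` up to translations. -/
theorem exists_eventually_eq_add_mul (h : F.IsLocalIsometryOn φ Ω) {U : Set S} {ζ : S → ℂ}
    (hζ : F.IsNaturalCoordinate U ζ) {z : ℂ} (hz : z ∈ Ω) (hzU : φ z ∈ U) :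
    ∃ ε : ℂ, ε ^ 2 = 1 ∧ ∀ᶠ u in 𝓝 (0 : ℂ), φ (z + u) ∈ U ∧ ζ (φ (z + u)) = ζ (φ z) + ε * u := by
  obtain ⟨r, hr, hB⟩ := Metric.isOpen_iff.1 (h.continuousOn.isOpen_inter_preimage h.isOpen hζ.1) z
    ⟨hz, hzU⟩
  have hder : ∀ w ∈ Metric.ball z r, HasDerivAt (ζ ∘ φ) (deriv (ζ ∘ φ) w) w ∧
      deriv (ζ ∘ φ) w ^ 2 = 1 := fun w hw => by
    obtain ⟨d, hd, hd2⟩ := h.hasDerivAt_comp hζ (hB hw).1 (hB hw).2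
    rw [hd.deriv]
    exact ⟨hd, hd2⟩
  have hdiff : DifferentiableOn ℂ (ζ ∘ φ) (Metric.ball z r) :=
    fun w hw => (hder w hw).1.differentiableAt.differentiableWithinAt
  have hpre : IsPreconnected (Metric.ball z r) := (convex_ball z r).isPreconnected
  obtain ⟨ε, hε, hconst⟩ : ∃ ε : ℂ, ε ^ 2 = 1 ∧ ∀ w ∈ Metric.ball z r, deriv (ζ ∘ φ) w = ε := by
    rcases hpre.eq_one_or_eq_neg_one_of_sq_eq (hdiff.deriv Metric.isOpen_ball).continuousOn
      (fun w hw => (hder w hw).2) with h1 | h1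
    · exact ⟨1, by simp, h1⟩
    · exact ⟨-1, by simp, h1⟩
  have heq : EqOn (ζ ∘ φ) (fun w => ζ (φ z) + ε * (w - z)) (Metric.ball z r) := by
    have hlin : ∀ w, HasDerivAt (fun w => ζ (φ z) + ε * (w - z)) ε w := fun w => by
      simpa using (((hasDerivAt_id w).sub_const z).const_mul ε).const_add (ζ (φ z))
    refine Metric.isOpen_ball.eqOn_of_deriv_eq hpre hdiff
      (fun w _ => (hlin w).differentiableAt.differentiableWithinAt)
      (fun w hw => by rw [hconst w hw, (hlin w).deriv]) (Metric.mem_ball_self hr) (by simp)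
  refine ⟨ε, hε, ?_⟩
  filter_upwards [Metric.ball_mem_nhds (0 : ℂ) hr] with u hu
  have hu' : z + u ∈ Metric.ball z r := by simpa using hu
  exact ⟨(hB hu').2, by simpa using heq hu'⟩

theorem exists_nhds_injOn (h : F.IsLocalIsometryOn φ Ω) {z : ℂ} (hz : z ∈ Ω) :
    ∃ N ∈ 𝓝 z, InjOn φ N := by
  obtain ⟨-, -, U, ζ, hzU, -, hζ⟩ := F.exists_isNaturalCoordinate (h.notMem_conePoints hz)
  obtain ⟨ε, hε, hu⟩ := h.exists_eventually_eq_add_mul hζ hz hzU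
  have hε0 : ε ≠ 0 := by rintro rfl; simp at hε
  have hs : Tendsto (fun y => y - z) (𝓝 z) (𝓝 0) := by
    simpa using (continuous_sub_right z).tendsto z
  refine ⟨_, hs.eventually hu, fun x hx y hy hxy => ?_⟩
  have hx2 := hx.2
  have hy2 := hy.2
  simp only [add_sub_cancel] at hx2 hy2
  rw [hxy, hy2] at hx2
  have := mul_left_cancel₀ hε0 (add_left_cancel hx2)
  simpa using this.symm

/-- If a local isometry takes the same value at `z` and `w`, its germs at the two points differ by
a plane isometry of the form `z + u ↦ w ± u`. -/
theorem exists_eventually_eq_of_eq (h : F.IsLocalIsometryOn φ Ω) {z w : ℂ} (hz : z ∈ Ω)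
    (hw : w ∈ Ω) (hzw : φ z = φ w) :
    ∃ ε : ℂ, ε ^ 2 = 1 ∧ ∀ᶠ u in 𝓝 (0 : ℂ), φ (w + ε * u) = φ (z + u) := by
  obtain ⟨-, -, U, ζ, hzU, -, hζ⟩ := F.exists_isNaturalCoordinate (h.notMem_conePoints hz)
  obtain ⟨ε₁, hε₁, h₁⟩ := h.exists_eventually_eq_add_mul hζ hz hzU
  obtain ⟨ε₂, hε₂, h₂⟩ := h.exists_eventually_eq_add_mul hζ hw (hzw ▸ hzU)
  refine ⟨ε₂ * ε₁, by rw [mul_pow, hε₁, hε₂, one_mul], ?_⟩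
  have ht : Tendsto (fun u : ℂ => ε₂ * ε₁ * u) (𝓝 0) (𝓝 0) := by
    simpa using (continuous_const_mul (ε₂ * ε₁)).tendsto 0
  filter_upwards [h₁, ht.eventually h₂] with u hu₁ hu₂
  refine hζ.2.2.1 hu₂.1 hu₁.1 ?_
  rw [hu₁.2, hu₂.2, hzw]
  linear_combination ε₁ * u * hε₂

/-- On a convex domain the coincidence of two germs continues to the whole overlap. -/
theorem eq_of_eventually_eq [T2Space S] (h : F.IsLocalIsometryOn φ Ω) (hconv : Convex ℝ Ω)
    {a b ε : ℂ} (ha : a ∈ Ω) (hb : b ∈ Ω)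
    (hgerm : ∀ᶠ u in 𝓝 (0 : ℂ), φ (b + ε * u) = φ (a + u)) {z : ℂ} (hz : z ∈ Ω)
    (hz' : b + ε * (z - a) ∈ Ω) : φ (b + ε * (z - a)) = φ z := by
  set ψ : ℂ → ℂ := fun z => b + ε * (z - a) with hψ
  have hψc : Continuous ψ := by fun_prop
  have hψadd : ∀ z u, ψ (z + u) = ψ z + ε * u := fun z u => by simp only [hψ]; ring
  have hψa : ψ a = b := by simp [hψ]
  have hsub : ∀ {x}, x ∈ interior {x | φ (ψ x) = φ x} → φ (ψ x) = φ x :=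
    fun hx => by simpa using interior_subset hx
  have htrans : ∀ x : ℂ, Tendsto (fun y => y - x) (𝓝 x) (𝓝 0) := fun x => by
    simpa using (continuous_sub_right x).tendsto x
  have hpre : IsPreconnected (Ω ∩ ψ ⁻¹' Ω) := by
    refine (hconv.inter ?_).isPreconnected
    intro x hx y hy s t hs ht hst
    have : ψ (s • x + t • y) = s • ψ x + t • ψ y := by
      have hst' : (s : ℂ) + t = 1 := by exact_mod_cast hst
      simp only [hψ, Complex.real_smul]
      linear_combination (-b + ε * a) * hst'
    rw [mem_preimage, this]
    exact hconv hx hy hs ht hst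
  have key : Ω ∩ ψ ⁻¹' Ω ⊆ interior {x | φ (ψ x) = φ x} := by
    refine hpre.subset_of_closure_inter_subset isOpen_interior
      ⟨a, ⟨ha, by simpa [hψa] using hb⟩, ?_⟩ ?_
    · rw [mem_interior_iff_mem_nhds]
      filter_upwards [(htrans a).eventually hgerm] with y hy
      simpa [hψ] using hy
    · rintro x ⟨hxcl, hx, hψx⟩
      have hcx : ContinuousAt (φ ∘ ψ) x :=
        ContinuousAt.comp (g := φ) (h.continuousAt hψx) hψc.continuousAt
      have hval : φ (ψ x) = φ x := by
        have hne : (𝓝[interior {x | φ (ψ x) = φ x}] x).NeBot :=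
          mem_closure_iff_nhdsWithin_neBot.1 hxcl
        refine tendsto_nhds_unique (l := 𝓝[interior {x | φ (ψ x) = φ x}] x) (hcx.tendsto.mono_left nhdsWithin_le_nhds)
          (((h.continuousAt hx).tendsto.mono_left nhdsWithin_le_nhds).congr' ?_)
        filter_upwards [self_mem_nhdsWithin] with y hy
        exact (hsub hy).symm
      obtain ⟨ε', -, hε'⟩ := h.exists_eventually_eq_of_eq hx hψx hval.symm
      obtain ⟨N, hN, hinj⟩ := h.exists_nhds_injOn hψx
      -- The germ at `x` is continued by some sign `ε'`; comparison at a point `y ≠ x` of the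
      -- open set where the coincidence is known shows `ε' = ε`.
      have hxcl' : x ∈ closure (interior {x | φ (ψ x) = φ x} ∩ {x}ᶜ) :=
        closure_minimal ((dense_compl_singleton x).open_subset_closure_inter isOpen_interior)
          isClosed_closure hxcl
      have hN₁ : ∀ᶠ y in 𝓝 x, ψ y ∈ N := hψc.continuousAt.eventually hN
      have hN₂ : ∀ᶠ y in 𝓝 x, ψ x + ε' * (y - x) ∈ N := by
        have hc : ContinuousAt (fun y => ψ x + ε' * (y - x)) x := by fun_prop
        exact hc.eventually (by simpa using hN)
      obtain ⟨y, ⟨⟨hy₁, hy₂⟩, hy₃⟩, hyu, hyx⟩ := mem_closure_iff_nhds.1 hxcl' _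
        ((hN₁.and hN₂).and ((htrans x).eventually hε'))
      rw [add_sub_cancel] at hy₃
      have hyeq : ψ x + ε' * (y - x) = ψ y :=
        hinj hy₂ hy₁ (hy₃.trans (hsub hyu).symm)
      have hψy : ψ y = ψ x + ε * (y - x) := by rw [← hψadd, add_sub_cancel]
      have hεε : ε' = ε := by
        rw [hψy] at hyeq
        exact mul_right_cancel₀ (sub_ne_zero.2 hyx) (add_left_cancel hyeq)
      rw [mem_interior_iff_mem_nhds]
      filter_upwards [(htrans x).eventually hε'] with y hy
      rwa [hεε, ← hψadd, add_sub_cancel] at hy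
  exact hsub (key ⟨hz, hz'⟩)

/-- A local isometry on a convex domain that identifies two distinct points is invariant under
the translation between them: the half-turn exchanging them would fix their midpoint, where the
map is locally injective. -/
theorem exists_translation [T2Space S] (h : F.IsLocalIsometryOn φ Ω) (hconv : Convex ℝ Ω)
    {a b : ℂ} (ha : a ∈ Ω) (hb : b ∈ Ω) (hab : φ a = φ b) {z : ℂ} (hz : z ∈ Ω)
    (hz' : z + (b - a) ∈ Ω) : φ (z + (b - a)) = φ z := by
  obtain ⟨ε, hε, hgerm⟩ := h.exists_eventually_eq_of_eq ha hb hab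
  have hcont := fun {z : ℂ} => h.eq_of_eventually_eq hconv ha hb hgerm (z := z)
  rcases sq_eq_one_iff.1 hε with rfl | rfl
  · have : b + 1 * (z - a) = z + (b - a) := by ring
    simpa only [this, hz', forall_true_left] using hcont hz
  · exfalso
    set m : ℂ := (1 / 2 : ℝ) • a + (1 / 2 : ℝ) • b with hm
    have hmΩ : m ∈ Ω := hconv ha hb (by norm_num) (by norm_num) (by norm_num)
    obtain ⟨N, hN, hinj⟩ := h.exists_nhds_injOn hmΩ
    have hNΩ : N ∩ Ω ∈ 𝓝 m := inter_mem hN (h.isOpen.mem_nhds hmΩ)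
    have h₁ : ∀ᶠ u in 𝓝 (0 : ℂ), m + u ∈ N ∩ Ω :=
      (show ContinuousAt (fun u => m + u) 0 by fun_prop).eventually (by simpa using hNΩ)
    have h₂ : ∀ᶠ u in 𝓝 (0 : ℂ), m - u ∈ N ∩ Ω :=
      (show ContinuousAt (fun u => m - u) 0 by fun_prop).eventually (by simpa using hNΩ)
    obtain ⟨u, ⟨hu₁, hu₂⟩, hu0⟩ :=
      ((h₁.and h₂).filter_mono nhdsWithin_le_nhds |>.and
        (self_mem_nhdsWithin : {(0 : ℂ)}ᶜ ∈ 𝓝[≠] (0 : ℂ))).exists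
    have hu3 : b + -1 * (m + u - a) = m - u := by
      simp only [hm, Complex.real_smul]; push_cast; ring
    have := hcont hu₁.2 (by rw [hu3]; exact hu₂.2)
    rw [hu3] at this
    have h4 := hinj hu₂.1 hu₁.1 this
    exact hu0 (show u = 0 by linear_combination (-1 / 2 : ℂ) * h4)

end IsLocalIsometryOn
/-! ### The developing map of a triangle is injective in the interior -/

namespace EuclideanTriangle

theorem isLocalIsometryOn (T : F.EuclideanTriangle) :
    F.IsLocalIsometryOn T.toFun (interior (convexHull ℝ (range T.vertex))) where
  isOpen := isOpen_interior
  continuousOn := T.continuousOn.mono interior_subset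
  isometric := T.isometric

/-- The vertices of the triangle, as an affine basis of the plane. -/
def basis (T : F.EuclideanTriangle) : AffineBasis (Fin 3) ℝ ℂ where
  toFun := T.vertex
  ind' := T.nondegenerate
  tot' := by
    rw [T.nondegenerate.affineSpan_eq_top_iff_card_eq_finrank_add_one]
    simp [Complex.finrank_real_complex]

theorem mem_convexHull_iff (T : F.EuclideanTriangle) {z : ℂ} :
    z ∈ convexHull ℝ (range T.vertex) ↔ ∀ i, 0 ≤ T.basis.coord i z := by
  have := T.basis.convexHull_eq_nonneg_coord
  exact Set.ext_iff.1 this z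

theorem mem_interior_iff (T : F.EuclideanTriangle) {z : ℂ} :
    z ∈ interior (convexHull ℝ (range T.vertex)) ↔ ∀ i, 0 < T.basis.coord i z :=
  Set.ext_iff.1 T.basis.interior_convexHull z

theorem coord_vertex (T : F.EuclideanTriangle) (i j : Fin 3) :
    T.basis.coord i (T.vertex j) = if i = j then 1 else 0 :=
  T.basis.coord_apply i j

theorem toFun_vertex_mem_conePoints (T : F.EuclideanTriangle) (i : Fin 3) :
    T.toFun (T.vertex i) ∈ F.conePoints := by
  simpa using (T.sides i (i + 1) (by fin_cases i <;> decide)).2.1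

/-- Apart from the vertices, no point of the triangle is mapped to a cone point. -/
theorem toFun_notMem_conePoints (T : F.EuclideanTriangle) {z : ℂ}
    (h0 : ∀ i, 0 ≤ T.basis.coord i z) (h1 : ∀ i, T.basis.coord i z < 1) :
    T.toFun z ∉ F.conePoints := by
  by_cases hpos : ∀ i, 0 < T.basis.coord i z
  · exact T.isLocalIsometryOn.notMem_conePoints (T.mem_interior_iff.2 hpos)
  push Not at hpos
  obtain ⟨i, hi⟩ := hpos
  have hi0 : T.basis.coord i z = 0 := le_antisymm hi (h0 i)
  have hsum := T.basis.sum_coord_apply_eq_one z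
  obtain ⟨j, k, hjk, hij, hik, hs⟩ : ∃ j k : Fin 3, j ≠ k ∧ i ≠ j ∧ i ≠ k ∧
      T.basis.coord j z + T.basis.coord k z = 1 := by
    rw [Fin.sum_univ_three] at hsum
    fin_cases i
    · exact ⟨1, 2, by decide, by decide, by decide, by simp at hi0; linarith⟩
    · exact ⟨0, 2, by decide, by decide, by decide, by simp at hi0; linarith⟩
    · exact ⟨0, 1, by decide, by decide, by decide, by simp at hi0; linarith⟩
  have hz : z = AffineMap.lineMap (T.vertex j) (T.vertex k) (T.basis.coord k z) := by
    refine T.basis.ext_elem fun l => ?_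
    rw [AffineMap.apply_lineMap, T.coord_vertex, T.coord_vertex, AffineMap.lineMap_apply_ring]
    have hl : l = i ∨ l = j ∨ l = k := by
      clear hs hsum hi0 hi
      revert i j k l; decide
    rcases hl with rfl | rfl | rfl
    · simp [hij, hik, hi0]
    · simp only [hjk, if_true, if_false]; linarith
    · simp [hjk.symm]
  obtain ⟨-, -, -, v, -, hv⟩ := T.sides j k hjk
  have h : T.toFun (AffineMap.lineMap (T.vertex j) (T.vertex k) (T.basis.coord k z)) ∉
      F.conePoints := (hv (T.basis.coord k z) ⟨by linarith [h1 j], h1 k⟩).1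
  rwa [← hz] at h

theorem coord_add_sub (T : F.EuclideanTriangle) (i : Fin 3) (z a b : ℂ) :
    T.basis.coord i (z + (b - a)) =
      T.basis.coord i z + (T.basis.coord i b - T.basis.coord i a) := by
  have h1 : T.basis.coord i ((b - a) +ᵥ z) = _ := (T.basis.coord i).map_vadd z (b - a)
  have h2 := (T.basis.coord i).linearMap_vsub b a
  rw [vadd_eq_add, vadd_eq_add, add_comm] at h1
  rw [h1, add_comm]
  congr 1

/-- If two interior points `a` and `b` have the same image, the map is invariant under the
translation from `a` to `b` also on the boundary of the triangle, by continuity. -/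
theorem toFun_add_sub_eq [T2Space S] (T : F.EuclideanTriangle) {a b z : ℂ}
    (ha : a ∈ interior (convexHull ℝ (range T.vertex)))
    (hb : b ∈ interior (convexHull ℝ (range T.vertex))) (hab : T.toFun a = T.toFun b)
    (hz : z ∈ convexHull ℝ (range T.vertex)) (hz' : z + (b - a) ∈ convexHull ℝ (range T.vertex)) :
    T.toFun (z + (b - a)) = T.toFun z := by
  set K := convexHull ℝ (range T.vertex)
  have hK : Convex ℝ K := convex_convexHull ℝ _
  -- Approach `z` along the segment from the interior point `a`.
  have hmem : ∀ {x y : ℂ}, x ∈ K → y ∈ interior K → ∀ t ∈ Ioo (0 : ℝ) 1,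
      x + t • (y - x) ∈ interior K := fun hx hy t ht =>
    hK.add_smul_sub_mem_interior hx hy ⟨ht.1, ht.2.le⟩
  have hlim : ∀ {x y : ℂ}, x ∈ K → y ∈ interior K →
      Filter.Tendsto (fun t : ℝ => T.toFun (x + t • (y - x))) (nhdsWithin 0 (Ioo 0 1))
        (nhds (T.toFun x)) := fun {x y} hx hy => by
    refine (T.continuousOn x hx).tendsto.comp (tendsto_nhdsWithin_iff.2 ⟨?_, ?_⟩)
    · have hc : Continuous fun t : ℝ => x + t • (y - x) := by fun_prop
      simpa using (hc.tendsto 0).mono_left nhdsWithin_le_nhds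
    · filter_upwards [self_mem_nhdsWithin] with t ht
      exact interior_subset (hmem hx hy t ht)
  have hne : (nhdsWithin (0 : ℝ) (Ioo 0 1)).NeBot := by
    rw [← mem_closure_iff_nhdsWithin_neBot, closure_Ioo zero_ne_one]
    simp
  refine tendsto_nhds_unique (hlim hz' hb) ((hlim hz ha).congr' ?_)
  filter_upwards [self_mem_nhdsWithin] with t ht
  have heq : z + (b - a) + t • (b - (z + (b - a))) = z + t • (a - z) + (b - a) := by
    simp only [Complex.real_smul]; ring
  have h1 := hmem hz' hb t ht
  rw [heq] at h1 ⊢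
  exact (T.isLocalIsometryOn.exists_translation hK.interior ha hb hab (hmem hz ha t ht) h1).symm

/-- Here the translation from `a` to `b` moves the vertex `k` to a point of the triangle that is not
a vertex. The map would take the same value at both, but only the first is sent to a cone point. -/
theorem false_of_forall_coord_le [T2Space S] (T : F.EuclideanTriangle) {a b : ℂ}
    (ha : a ∈ interior (convexHull ℝ (range T.vertex)))
    (hb : b ∈ interior (convexHull ℝ (range T.vertex))) (hab : T.toFun a = T.toFun b)
    (hne : a ≠ b) (k : Fin 3) (hk : ∀ i ≠ k, T.basis.coord i a ≤ T.basis.coord i b) : False := by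
  have ha0 := T.mem_interior_iff.1 ha
  have hb0 := T.mem_interior_iff.1 hb
  have hsum : ∑ i, (T.basis.coord i b - T.basis.coord i a) = 0 := by
    rw [Finset.sum_sub_distrib, T.basis.sum_coord_apply_eq_one, T.basis.sum_coord_apply_eq_one,
      sub_self]
  have hlt1 : ∀ {z}, (∀ i, 0 < T.basis.coord i z) → ∀ i, T.basis.coord i z < 1 := by
    intro z hz i
    have hs := T.basis.sum_coord_apply_eq_one z
    rw [Fin.sum_univ_three] at hs
    have := hz 0; have := hz 1; have := hz 2
    fin_cases i <;> simp <;> linarith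
  have hklt : T.basis.coord k b < T.basis.coord k a := by
    by_contra! hge
    refine hne (T.basis.ext_elem fun i => ?_)
    have hnn : ∀ i ∈ Finset.univ, 0 ≤ T.basis.coord i b - T.basis.coord i a := fun i _ =>
      sub_nonneg.2 (if h : i = k then h ▸ hge else hk i h)
    linarith [(Finset.sum_eq_zero_iff_of_nonneg hnn).1 hsum i (Finset.mem_univ i)]
  have hcoord : ∀ i, 0 ≤ T.basis.coord i (T.vertex k + (b - a)) ∧
      T.basis.coord i (T.vertex k + (b - a)) < 1 := by
    intro i
    rw [T.coord_add_sub, T.coord_vertex]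
    have h1 := ha0 i
    have h2 := hb0 i
    have h3 := hlt1 ha0 i
    have h4 := hlt1 hb0 i
    split_ifs with h
    · subst h
      constructor <;> linarith
    · have := hk i h
      constructor <;> linarith
  refine T.toFun_notMem_conePoints (fun i => (hcoord i).1) (fun i => (hcoord i).2) ?_
  rw [T.toFun_add_sub_eq ha hb hab (subset_convexHull ℝ _ (mem_range_self k))
    (T.mem_convexHull_iff.2 fun i => (hcoord i).1)]
  exact T.toFun_vertex_mem_conePoints k

theorem injOn_interior [T2Space S] (T : F.EuclideanTriangle) :
    InjOn T.toFun (interior (convexHull ℝ (range T.vertex))) := by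
  intro a ha b hb hab
  by_contra hne
  -- Two of the three barycentric coordinates vary in the same direction from `a` to `b`.
  obtain ⟨k, hk | hk⟩ : ∃ k : Fin 3, (∀ i ≠ k, T.basis.coord i a ≤ T.basis.coord i b) ∨
      (∀ i ≠ k, T.basis.coord i b ≤ T.basis.coord i a) := by
    simp only [Fin.forall_fin_succ, Fin.exists_fin_succ]
    rcases le_total (T.basis.coord 0 a) (T.basis.coord 0 b) with h0 | h0 <;>
    rcases le_total (T.basis.coord 1 a) (T.basis.coord 1 b) with h1 | h1 <;>
    rcases le_total (T.basis.coord 2 a) (T.basis.coord 2 b) with h2 | h2 <;>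
    simp [h0, h1, h2]
  · exact T.false_of_forall_coord_le ha hb hab hne k hk
  · exact T.false_of_forall_coord_le hb ha hab.symm (Ne.symm hne) k hk

end EuclideanTriangle

/-! ### The area of an embedded piece of the plane -/

open scoped Topology in
/-- The area of an embedded piece of the plane is computed in a natural coordinate: a special
linear deformation does not change it. -/
theorem IsLocalIsometryOn.volume_eq_lintegral {φ : ℂ → S} {Ω P : Set ℂ}
    (h : F.IsLocalIsometryOn φ Ω) (hinj : InjOn φ Ω) {A : Matrix.SpecialLinearGroup (Fin 2) ℝ}
    {U : Set S} {ζ : S → ℂ} (hζ₀ : F₀.IsNaturalCoordinate U ζ)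
    (hζ : F.IsNaturalCoordinate U (slAct A ∘ ζ)) {e : OpenPartialHomeomorph S ℂ}
    (he : e ∈ F₀.atlas) (hUe : U ⊆ e.source) (hP : MeasurableSet P) (hPΩ : P ⊆ Ω)
    (hPU : MapsTo φ P U) :
    MeasurableSet (e '' (φ '' P)) ∧ volume P = ∫⁻ w in e '' (φ '' P), ‖F₀.q e w‖ₑ := by
  have hm : MeasurableSet (e '' (φ '' P)) := by
    rw [← image_comp]
    exact hP.image_of_continuousOn_injOn
      (e.continuousOn.comp (h.continuousOn.mono hPΩ) fun z hz => hUe (hPU hz))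
      fun z hz w hw hzw => hinj (hPΩ hz) (hPΩ hw) (e.injOn (hUe (hPU hz)) (hUe (hPU hw)) hzw)
  refine ⟨hm, ?_⟩
  have hdev : volume ((slAct A ∘ ζ ∘ φ) '' P) = volume P := by
    have hd := fun z (hz : z ∈ P) => h.hasDerivAt_comp hζ (hPΩ hz) (hPU hz)
    have := lintegral_image_eq_lintegral_enorm_deriv_sq_mul hP (f := slAct A ∘ ζ ∘ φ)
      (f' := deriv ((slAct A ∘ ζ) ∘ φ))
      (fun z hz => by obtain ⟨d, hd, -⟩ := hd z hz; rw [hd.deriv]; exact hd)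
      (fun z hz w hw hzw =>
        hinj (hPΩ hz) (hPΩ hw) (hζ.2.2.1 (hPU hz) (hPU hw) hzw)) (fun _ => 1)
    rw [setLIntegral_one] at this
    rw [this, ← setLIntegral_one P]
    refine setLIntegral_congr_fun hP fun z hz => ?_
    obtain ⟨d, hd, hd2⟩ := hd z hz
    rw [hd.deriv, ← enorm_pow, hd2]
    simp
  have hchart : volume (ζ '' (φ '' P)) = ∫⁻ w in e '' (φ '' P), ‖F₀.q e w‖ₑ := by
    have hsub : φ '' P ⊆ U := image_subset_iff.2 hPU
    have hd : ∀ x ∈ φ '' P, ∃ d : ℂ, HasDerivAt (ζ ∘ e.symm) d (e x) ∧ d ^ 2 = F₀.q e (e x) :=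
      fun x hx => hζ₀.2.2.2 x (hsub hx) e he (hUe (hsub hx))
    have hleft : ∀ x ∈ φ '' P, e.symm (e x) = x := fun x hx => e.left_inv (hUe (hsub hx))
    have himg : (ζ ∘ e.symm) '' (e '' (φ '' P)) = ζ '' (φ '' P) := by
      rw [← image_comp]
      exact image_congr fun x hx => by simp [hleft x hx]
    rw [← himg, ← setLIntegral_one, lintegral_image_eq_lintegral_enorm_deriv_sq_mul hm
      (f' := deriv (ζ ∘ e.symm))]
    · refine setLIntegral_congr_fun hm ?_
      rintro _ ⟨x, hx, rfl⟩
      obtain ⟨d, hd, hd2⟩ := hd x hx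
      simp only [mul_one]
      rw [hd.deriv, ← hd2, enorm_pow]
    · rintro _ ⟨x, hx, rfl⟩
      obtain ⟨d, hd, -⟩ := hd x hx
      rwa [hd.deriv]
    · rintro _ ⟨x, hx, rfl⟩ _ ⟨y, hy, rfl⟩ hxy
      simp only [Function.comp_apply, hleft x hx, hleft y hy] at hxy
      rw [hζ₀.2.2.1 (hsub hx) (hsub hy) hxy]
  rw [← hchart, ← hdev, image_comp, volume_image_slAct, image_comp]

/-- An embedded piece of the plane in a deformation of `F₀` has at most the area of `F₀`: cut it
into countably many pieces, each of them lying in the domain of a natural coordinate of `F₀`. -/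
theorem IsLocalIsometryOn.volume_le_area {φ : ℂ → S} {Ω : Set ℂ}
    (h : F.IsLocalIsometryOn φ Ω) (hinj : InjOn φ Ω) {A : Matrix.SpecialLinearGroup (Fin 2) ℝ}
    (hA : IsDeformation A F₀ F) : volume Ω ≤ F₀.area := by
  have hreg : ∀ z : Ω, φ z ∉ F₀.conePoints := fun z => hA.1 ▸ h.notMem_conePoints z.2
  choose e he U ζ hzU hUe hζ using fun z : Ω => F₀.exists_isNaturalCoordinate (hreg z)
  have hopen : ∀ z : Ω, IsOpen (Ω ∩ φ ⁻¹' U z) := fun z =>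
    h.continuousOn.isOpen_inter_preimage h.isOpen (hζ z).1
  rcases isEmpty_or_nonempty Ω with hΩ | hΩ
  · rw [isEmpty_coe_sort.1 hΩ]
    simp
  obtain ⟨t, ht, htU⟩ := TopologicalSpace.isOpen_iUnion_countable _ hopen
  have hcover : Ω ⊆ ⋃ z ∈ t, Ω ∩ φ ⁻¹' U z := by
    rw [htU]
    exact fun z hz => mem_iUnion.2 ⟨⟨z, hz⟩, hz, hzU ⟨z, hz⟩⟩
  have htne : t.Nonempty := by
    obtain ⟨z⟩ := hΩ
    obtain ⟨w, hw, -⟩ := mem_iUnion₂.1 (hcover z.2)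
    exact ⟨w, hw⟩
  obtain ⟨c, rfl⟩ := ht.exists_eq_range htne
  set P : ℕ → Set ℂ := disjointed fun n => Ω ∩ φ ⁻¹' U (c n) with hPdef
  have hPsub : ∀ n, P n ⊆ Ω ∩ φ ⁻¹' U (c n) := fun n => disjointed_subset _ n
  have hPm : ∀ n, MeasurableSet (P n) := fun n =>
    MeasurableSet.disjointed (fun n => (hopen (c n)).measurableSet) n
  have hPd : Pairwise (Function.onFun Disjoint P) := disjoint_disjointed _
  have hPU : ⋃ n, P n = Ω := by
    rw [hPdef, iUnion_disjointed]
    refine subset_antisymm (iUnion_subset fun n => inter_subset_left) ?_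
    rwa [biUnion_range] at hcover
  have hpiece := fun n => h.volume_eq_lintegral hinj (hζ (c n)) (hA.2 _ _ (hζ (c n))) (he (c n))
    (hUe (c n)) (hPm n) ((hPsub n).trans inter_subset_left) fun z hz => (hPsub n hz).2
  rw [← hPU, measure_iUnion hPd hPm]
  refine ENNReal.tsum_le_of_sum_range_le fun n => ?_
  rw [← Fin.sum_univ_eq_sum_range (fun i => volume (P i)) n]
  simp only [fun i => (hpiece i).2]
  refine F₀.sum_le_area (fun i : Fin n => e (c i)) (fun i => φ '' P i) (fun i => ⟨he _, ?_,
    (hpiece i).1⟩) fun i j hij => ?_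
  · rintro _ ⟨z, hz, rfl⟩
    exact hUe _ (hPsub i hz).2
  · refine disjoint_image_image fun z hz w hw hzw => ?_
    exact (hPd (fun hv => hij (Fin.ext hv))).ne_of_mem hz hw
      (hinj (hPsub i hz).1 (hPsub j hw).1 hzw)

theorem EuclideanTriangle.volume_le_area [T2Space S] (T : F.EuclideanTriangle)
    {A : Matrix.SpecialLinearGroup (Fin 2) ℝ} (hA : IsDeformation A F₀ F) :
    volume (convexHull ℝ (range T.vertex)) ≤ F₀.area := by
  have hfr := (convex_convexHull ℝ (range T.vertex)).addHaar_frontier volume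
  calc volume (convexHull ℝ (range T.vertex))
      ≤ volume (interior (convexHull ℝ (range T.vertex)) ∪
          frontier (convexHull ℝ (range T.vertex))) := by
        refine measure_mono fun z hz => ?_
        by_cases hi : z ∈ interior (convexHull ℝ (range T.vertex))
        · exact Or.inl hi
        · exact Or.inr ⟨subset_closure hz, hi⟩
    _ ≤ volume (interior (convexHull ℝ (range T.vertex))) + 0 := hfr ▸ measure_union_le _ _
    _ ≤ F₀.area := by
        rw [add_zero]
        exact T.isLocalIsometryOn.volume_le_area T.injOn_interior hA

end FlatStructure
end

theorem mainTheorem9 {S : Type*} [TopologicalSpace S] [T2Space S] [CompactSpace S]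
    [ConnectedSpace S] (F₀ : FlatStructure S) :
    ∃ A : ℝ, 0 < A ∧ F₀.area = ENNReal.ofReal A ∧
      ∀ F ∈ F₀.teichmullerDisk, ∀ T : F.EuclideanTriangle, T.area ≤ A := by
  refine ⟨F₀.area.toReal, ENNReal.toReal_pos F₀.area_pos.ne' F₀.area_lt_top.ne,
    (ENNReal.ofReal_toReal F₀.area_lt_top.ne).symm, ?_⟩
  rintro F ⟨A, hA⟩ T
  exact ENNReal.toReal_mono F₀.area_lt_top.ne (T.volume_le_area hA)
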